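/- Let $\mathcal C$ be a category with finite products and weak equalisers (a weak equaliser satisfies the universal property of an equaliser except for the uniqueness of the factorisation). An element $x\in X$ is an arrow $x\colon 1\to X$, and for $f\colon X\to Y$ and $y\in Y$ we write $y\mathrel{\varepsilon} f$ if $y=fx$ for some $x\in X$. An arrow $f\colon X\to Y$ is surjective if $y\mathrel{\varepsilon} f$ for all $y\in Y$, and $Y$ is a choice object if every surjective arrow $f\colon X\to Y$ has a section. Let $Y\xrightarrow{g}X\xrightarrow{f}I$ be arrows of $\mathcal C$. A family of pseudo-relations over $f,g$ is a pair of arrows $h\colon J\to I$, $r\colon R\to J\times X\times Y$ such that for all $j\in J$, $x\in X$, $y\in Y$: $$\langle j,x,y\rangle\mathrel{\varepsilon} r\ \Rightarrow\ gy=x,\qquad\text{and}\qquad fx=hj\ \Leftrightarrow\ (\exists y\in Y)\ \langle j,x,y\rangle\mathrel{\varepsilon} r .$$ A pseudo-relation over $f,g$ with domain index $i\in I$ is an arrow $r\colon R\to X\times Y$ which, together with $i\colon 1\to I$, forms such a family for $J=1$. A family of pseudo-relations $\varphi\colon F\to I$, $\alpha\colon P\to F\times X\times Y$ over $f,g$ is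 full if for every pseudo-relation $r$ over $f,g$ with domain index $i$ there is $c\in F$ such that $\varphi c=i$ and, for all $x\in X$ and $y\in Y$, $\langle c,x,y\rangle\mathrel{\varepsilon}\alpha$ implies $\langle x,y\rangle\mathrel{\varepsilon} r$. The category $\mathcal C$ is closed for pseudo-relations if every pair of composable arrows has a full family of pseudo-relations. The exact completion $\mathrm{Ex}(\mathcal C)$ has as objects the pseudo-equivalence relations in $\mathcal C$, i.e. the arrows $r=\langle r_1,r_2\rangle\colon R\to X\times X$ (not necessarily monic) for which there are (not necessarily unique) arrows $\rho\colon X\to R$, $\sigma\colon R\to R$, $\tau\colon P\to R$ with $r\rho=\langle \mathrm{id},\mathrm{id}\rangle$, $r\sigma=\langle r_2,r_1\rangle$ and $r\tau=\langle r_1p_1,r_2p_2\rangle$, where $R\xleftarrow{p_1}P\xrightarrow{p_2}R$ is a weak pullback of $R\xrightarrow{r_2}X\xleftarrow{r_1}R$. Arrows from $r\colon R\to X\times X$ to $s\colon S\to Y\times Y$ are equivalence classes of arrows $f\colon X\to Y$ for which there is $\hat f\colon R\to S$ with $s\hat f=(f\times f)r$, where $f$ and $g$ are equivalent if $\langle f,g\rangle=sh$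 for some $h\colon X\to S$. **Theorem.** Let $\mathcal C$ be a category with finite products and weak equalisers in which every object is a choice object. If $\mathcal C$ is closed for pseudo-relations, then $\mathrm{Ex}(\mathcal C)$ is locally cartesian closed, i.e. it has finite limits and all its slice categories are cartesian closed. -/

import Mathlib

open CategoryTheory CategoryTheory.Limits

universe v u

noncomputable section

namespace WeaklyCartesian

/-- A category with finite products and weak equalisers has weak pullbacks. -/
instance hasWeakPullbacks_of_weaklyCartesian (C : Type u) [Category.{v} C]
    [HasFiniteProducts C] [HasWeakEqualizers C] : HasWeakPullbacks C :=
  hasWeakPullbacks_of_hasBinaryProducts_of_hasWeakEqualizers C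

section Elements

variable {C : Type u} [Category.{v} C] [HasFiniteProducts C]

/-- An element of `X` is a global element, i.e. an arrow from the terminal object to `X`. -/
abbrev Elem (X : C) : Type v := ⊤_ C ⟶ X

/-- The element `y` of `Y` belongs to the arrow `f : X ⟶ Y` if it is the image under `f` of
some element of `X`. -/
def Mem {X Y : C} (y : Elem Y) (f : X ⟶ Y) : Prop :=
  ∃ x : Elem X, x ≫ f = y

/-- An arrow is surjective if every element of its codomain belongs to it. -/
def IsSurjective {X Y : C} (f : X ⟶ Y) : Prop :=
  ∀ y : Elem Y, Mem y f

/-- `Y` is a choice object if every surjection onto `Y` has a section. -/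
def IsChoiceObject (Y : C) : Prop :=
  ∀ ⦃X : C⦄ (f : X ⟶ Y), IsSurjective f → ∃ g : Y ⟶ X, g ≫ f = 𝟙 Y

/-- The pair of an element of `X` and an element of `Y`. -/
abbrev pair {X Y : C} (x : Elem X) (y : Elem Y) : Elem (X ⨯ Y) :=
  prod.lift x y

/-- The triple of an element of `J`, an element of `X` and an element of `Y`. -/
abbrev triple {J X Y : C} (j : Elem J) (x : Elem X) (y : Elem Y) : Elem (J ⨯ (X ⨯ Y)) :=
  prod.lift j (prod.lift x y)

/-- For arrows `g : Y ⟶ X` and `f : X ⟶ I`, a pair consisting of `h : J ⟶ I` and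
`r : R ⟶ J ⨯ (X ⨯ Y)` is a family of pseudo-relations over `f, g` if it is a family of partial
sections of `g` and it has domains indexed by `f`. The arrow `r` is not required to be monic. -/
structure IsFamilyOfPseudoRelations {Y X I J R : C} (g : Y ⟶ X) (f : X ⟶ I)
    (h : J ⟶ I) (r : R ⟶ J ⨯ (X ⨯ Y)) : Prop where
  isSection : ∀ (j : Elem J) (x : Elem X) (y : Elem Y), Mem (triple j x y) r → y ≫ g = x
  domain : ∀ (j : Elem J) (x : Elem X), x ≫ f = j ≫ h ↔ ∃ y : Elem Y, Mem (triple j x y) r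

/-- `r : R ⟶ X ⨯ Y` is a pseudo-relation over `f, g` with domain index the element `i` of `I`:
it is a family of pseudo-relations indexed by the terminal object. -/
def IsPseudoRelation {Y X I R : C} (g : Y ⟶ X) (f : X ⟶ I) (i : Elem I) (r : R ⟶ X ⨯ Y) : Prop :=
  IsFamilyOfPseudoRelations g f i (prod.lift (terminal.from R) r)

/-- A full family of pseudo-relations over `f, g`: every pseudo-relation `r` over `f, g` with
domain index `i` contains a member of the family with the same domain index. -/
structure IsFullFamily {Y X I F P : C} (g : Y ⟶ X) (f : X ⟶ I)
    (φ : F ⟶ I) (α : P ⟶ F ⨯ (X ⨯ Y)) : Prop where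
  isFamily : IsFamilyOfPseudoRelations g f φ α
  full : ∀ ⦃R : C⦄ (r : R ⟶ X ⨯ Y) (i : Elem I), IsPseudoRelation g f i r →
    ∃ c : Elem F, c ≫ φ = i ∧
      ∀ (x : Elem X) (y : Elem Y), Mem (triple c x y) α → Mem (pair x y) r

variable (C) in
/-- A category is closed for pseudo-relations if every pair of composable arrows has a full
family of pseudo-relations. -/
def ClosedForPseudoRelations : Prop :=
  ∀ ⦃Y X I : C⦄ (g : Y ⟶ X) (f : X ⟶ I),
    ∃ (F P : C) (φ : F ⟶ I) (α : P ⟶ F ⨯ (X ⨯ Y)), IsFullFamily g f φ α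

end Elements

section ExactCompletion

variable {C : Type u} [Category.{v} C] [HasFiniteProducts C] [HasWeakEqualizers C]

/-- A pseudo-equivalence relation on `X` is an arrow `r : R ⟶ X ⨯ X` (not necessarily monic) for
which there are arrows witnessing reflexivity, symmetry and transitivity, the last one being
defined on a weak pullback of the second component of `r` along the first one. -/
structure IsPseudoEquivRel {X R : C} (r : R ⟶ X ⨯ X) : Prop where
  refl : ∃ ρ : X ⟶ R, ρ ≫ r = diag X
  symm : ∃ σ : R ⟶ R, σ ≫ r = prod.lift (r ≫ prod.snd) (r ≫ prod.fst)
  trans : ∃ τ : weakPullback (r ≫ prod.snd) (r ≫ prod.fst) ⟶ R,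
    τ ≫ r = prod.lift
      (weakPullback.fst (r ≫ prod.snd) (r ≫ prod.fst) ≫ r ≫ prod.fst)
      (weakPullback.snd (r ≫ prod.snd) (r ≫ prod.fst) ≫ r ≫ prod.snd)

/-- Objects of the exact completion of `C`: pseudo-equivalence relations in `C`. -/
structure ExactCompletion (C : Type u) [Category.{v} C] [HasFiniteProducts C]
    [HasWeakEqualizers C] : Type max u v where
  carrier : C
  dom : C
  rel : dom ⟶ carrier ⨯ carrier
  isPseudoEquivRel : IsPseudoEquivRel rel

namespace ExactCompletion

/-- Arrows of `C` between the carriers that can be lifted to the relations. -/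
def PreHom (A B : ExactCompletion C) : Type v :=
  { f : A.carrier ⟶ B.carrier // ∃ f' : A.dom ⟶ B.dom, f' ≫ B.rel = A.rel ≫ prod.map f f }

/-- Two arrows into the carrier of `B` are related if their pairing factors through the relation
of `B`. -/
def Related (B : ExactCompletion C) {W : C} (f g : W ⟶ B.carrier) : Prop :=
  ∃ h : W ⟶ B.dom, h ≫ B.rel = prod.lift f g

theorem Related.refl (B : ExactCompletion C) {W : C} (f : W ⟶ B.carrier) : B.Related f f := by
  obtain ⟨ρ, hρ⟩ := B.isPseudoEquivRel.refl
  exact ⟨f ≫ ρ, by rw [Category.assoc, hρ]; ext <;> simp⟩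

theorem Related.symm {B : ExactCompletion C} {W : C} {f g : W ⟶ B.carrier}
    (h : B.Related f g) : B.Related g f := by
  obtain ⟨k, hk⟩ := h
  obtain ⟨σ, hσ⟩ := B.isPseudoEquivRel.symm
  have h1 : k ≫ B.rel ≫ prod.fst = f := by rw [← Category.assoc, hk, prod.lift_fst]
  have h2 : k ≫ B.rel ≫ prod.snd = g := by rw [← Category.assoc, hk, prod.lift_snd]
  exact ⟨k ≫ σ, by rw [Category.assoc, hσ, prod.comp_lift, h1, h2]⟩

theorem Related.trans {B : ExactCompletion C} {W : C} {f g k : W ⟶ B.carrier}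
    (h : B.Related f g) (h' : B.Related g k) : B.Related f k := by
  obtain ⟨a, ha⟩ := h
  obtain ⟨b, hb⟩ := h'
  obtain ⟨τ, hτ⟩ := B.isPseudoEquivRel.trans
  have a1 : a ≫ B.rel ≫ prod.fst = f := by rw [← Category.assoc, ha, prod.lift_fst]
  have a2 : a ≫ B.rel ≫ prod.snd = g := by rw [← Category.assoc, ha, prod.lift_snd]
  have b1 : b ≫ B.rel ≫ prod.fst = g := by rw [← Category.assoc, hb, prod.lift_fst]
  have b2 : b ≫ B.rel ≫ prod.snd = k := by rw [← Category.assoc, hb, prod.lift_snd]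
  obtain ⟨l, l1, l2⟩ := weakPullback.exists_lift (B.rel ≫ prod.snd) (B.rel ≫ prod.fst) a b
    (a2.trans b1.symm)
  refine ⟨l ≫ τ, ?_⟩
  rw [Category.assoc, hτ, prod.comp_lift, ← Category.assoc l, l1, ← Category.assoc l, l2, a1, b2]

theorem Related.comp_left {B : ExactCompletion C} {V W : C} (e : V ⟶ W) {f g : W ⟶ B.carrier}
    (h : B.Related f g) : B.Related (e ≫ f) (e ≫ g) := by
  obtain ⟨k, hk⟩ := h
  exact ⟨e ≫ k, by rw [Category.assoc, hk, prod.comp_lift]⟩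

theorem Related.comp_right {A B : ExactCompletion C} {W : C} {f g : W ⟶ A.carrier}
    (h : A.Related f g) (e : PreHom A B) : B.Related (f ≫ e.1) (g ≫ e.1) := by
  obtain ⟨k, hk⟩ := h
  obtain ⟨e', he'⟩ := e.2
  exact ⟨k ≫ e', by rw [Category.assoc, he', ← Category.assoc, hk, prod.lift_map]⟩

/-- Equality of arrows in the exact completion. -/
instance preHomSetoid (A B : ExactCompletion C) : Setoid (PreHom A B) where
  r f g := B.Related f.1 g.1
  iseqv := ⟨fun f => Related.refl B f.1, fun h => h.symm, fun h h' => h.trans h'⟩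

/-- The identity arrow. -/
def PreHom.id (A : ExactCompletion C) : PreHom A A :=
  ⟨𝟙 A.carrier, 𝟙 A.dom, by simp⟩

/-- Composition of liftable arrows. -/
def PreHom.comp {A B D : ExactCompletion C} (f : PreHom A B) (g : PreHom B D) : PreHom A D :=
  ⟨f.1 ≫ g.1, by
    obtain ⟨f', hf⟩ := f.2
    obtain ⟨g', hg⟩ := g.2
    exact ⟨f' ≫ g', by
      rw [Category.assoc, hg, ← Category.assoc, hf, Category.assoc, prod.map_map]⟩⟩

/-- The exact completion of a category with finite products and weak equalisers: arrows are
equivalence classes of liftable arrows between the carriers. -/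
instance category : Category.{v} (ExactCompletion C) where
  Hom A B := Quotient (preHomSetoid A B)
  id A := Quotient.mk _ (PreHom.id A)
  comp {A B D} := Quotient.map₂ PreHom.comp (fun _ f' hf g _ hg =>
    (Related.comp_right hf g).trans (Related.comp_left f'.1 hg))
  id_comp {A B} f := by
    induction f using Quotient.inductionOn with
    | h f => exact congrArg (Quotient.mk (preHomSetoid A B)) (Subtype.ext (Category.id_comp f.1))
  comp_id {A B} f := by
    induction f using Quotient.inductionOn with
    | h f => exact congrArg (Quotient.mk (preHomSetoid A B)) (Subtype.ext (Category.comp_id f.1))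
  assoc {A B D E} f g h := by
    induction f using Quotient.inductionOn with
    | h f =>
      induction g using Quotient.inductionOn with
      | h g =>
        induction h using Quotient.inductionOn with
        | h h =>
          exact congrArg (Quotient.mk (preHomSetoid A E))
            (Subtype.ext (Category.assoc f.1 g.1 h.1))

end ExactCompletion

end ExactCompletion

/-- A category is locally cartesian closed if it has finite limits and all of its slices are
cartesian closed, for the cartesian structure given by pullbacks. -/
structure IsLocallyCartesianClosed (D : Type u) [Category.{v} D] : Prop where
  hasFiniteLimits : HasFiniteLimits D
  cartesianClosed_over : ∀ X : D,
    letI : CartesianMonoidalCategory (Over X) := Over.cartesianMonoidalCategory X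
    Nonempty (MonoidalClosed (Over X))

end WeaklyCartesian

end

noncomputable section

namespace WeaklyCartesian

/-! The theorem reduces to reasoning with elements. Since every object is a choice object, an arrow
factors through `r` as soon as each of its values belongs to `r` (`exists_factor`). Hence `Ex(C)`
can be handled through points: an object becomes a set presented as a quotient of the elements of
some object by a definable equivalence relation, and an arrow becomes a map induced by an arrow on
representatives. `hom_ext_point`, `exists_mapPoint_eq` and `exists_point_equiv` give faithfulness,
fullness and the realisation of every presented set.

Definable predicates have an internal logic. Weak limits give equality, conjunction, substitution
and existence; full families give universal quantification and implication
(`ElemDefinable.forall_along`). By choice, a map with definable graph is an arrow. Finite limits are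
then computed as for sets.

The exponential of `A` and `B` over `X` should be the set of pairs of a point `x` and a definable
function between the fibres over `x`. The crux is that this set is presentable
(`exists_presentation_localSections`). A full family need not consist of functions, but its
single-valued members form a definable part. A member contained in a function, with the same domain,
equals that function, so fullness makes this part exhaust all definable functions. -/

/-- Every object is a choice object. -/
class HasChoice (C : Type u) [Category.{v} C] [HasFiniteProducts C] : Prop where
  isChoiceObject : ∀ Y : C, IsChoiceObject Y

/-- Every pair of composable arrows has a full family of pseudo-relations. -/
class HasFullFamilies (C : Type u) [Category.{v} C] [HasFiniteProducts C] : Prop where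
  closed : ClosedForPseudoRelations C

/-! ### Definable predicates on elements and their closure properties -/

section Definability

variable {C : Type u} [Category.{v} C] [HasFiniteProducts C]

theorem elem_comp_toUnit {X Y : C} (x : Elem X) (y : Elem Y) :
    x ≫ terminal.from X ≫ y = y := by
  rw [← Category.assoc, Subsingleton.elim (x ≫ terminal.from X) (𝟙 _), Category.id_comp]

theorem elem_prod_eta {X Y : C} (w : Elem (X ⨯ Y)) :
    prod.lift (w ≫ prod.fst) (w ≫ prod.snd) = w := by
  ext
  · rw [prod.lift_fst]
  · rw [prod.lift_snd]

theorem Mem.comp {X Y Z : C} {y : Elem Y} {f : X ⟶ Y} (h : Mem y f) (g : Y ⟶ Z) :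
    Mem (y ≫ g) (f ≫ g) := by
  obtain ⟨x, rfl⟩ := h
  exact ⟨x, (Category.assoc _ _ _).symm⟩

theorem mem_comp_iff {X Y Z : C} {f : X ⟶ Y} {g : Y ⟶ Z} {z : Elem Z} :
    Mem z (f ≫ g) ↔ ∃ y, Mem y f ∧ y ≫ g = z := by
  constructor
  · rintro ⟨x, rfl⟩
    exact ⟨x ≫ f, ⟨x, rfl⟩, Category.assoc _ _ _⟩
  · rintro ⟨y, h, rfl⟩
    exact h.comp g

theorem mem_lift_terminal_iff {X Y R : C} (r : R ⟶ X ⨯ Y) (j : Elem (⊤_ C)) (x : Elem X)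
    (y : Elem Y) : Mem (triple j x y) (prod.lift (terminal.from R) r) ↔ Mem (pair x y) r := by
  constructor
  · rintro ⟨z, hz⟩
    exact ⟨z, by simpa only [Category.assoc, prod.lift_snd] using congrArg (· ≫ prod.snd) hz⟩
  · rintro ⟨z, hz⟩
    refine ⟨z, ?_⟩
    rw [prod.comp_lift, hz, Subsingleton.elim (z ≫ terminal.from R) j]

theorem isPseudoRelation_iff {Y X I R : C} {g : Y ⟶ X} {f : X ⟶ I} {i : Elem I} {r : R ⟶ X ⨯ Y} :
    IsPseudoRelation g f i r ↔ (∀ x y, Mem (pair x y) r → y ≫ g = x) ∧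
      ∀ x, x ≫ f = i ↔ ∃ y, Mem (pair x y) r := by
  have key : ∀ j : Elem (⊤_ C), j ≫ i = i := fun j => by
    rw [Subsingleton.elim j (𝟙 _), Category.id_comp]
  constructor
  · rintro ⟨h1, h2⟩
    refine ⟨fun x y h => h1 (𝟙 _) x y ((mem_lift_terminal_iff _ _ _ _).2 h), fun x => ?_⟩
    have := h2 (𝟙 _) x
    simpa only [key, mem_lift_terminal_iff] using this
  · rintro ⟨h1, h2⟩
    refine ⟨fun j x y h => h1 x y ((mem_lift_terminal_iff _ _ _ _).1 h), fun j x => ?_⟩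
    simpa only [key, mem_lift_terminal_iff] using h2 x

/-- A predicate on the elements of `W` is definable if it is membership to an arrow. -/
def ElemDefinable {W : C} (P : Elem W → Prop) : Prop :=
  ∃ (R : C) (r : R ⟶ W), ∀ w, P w ↔ Mem w r

theorem ElemDefinable.congr {W : C} {P Q : Elem W → Prop} (hP : ElemDefinable P)
    (h : ∀ w, Q w ↔ P w) : ElemDefinable Q := by
  rwa [show Q = P from funext fun w => propext (h w)]

theorem ElemDefinable.exists_along {V W : C} {P : Elem V → Prop} (hP : ElemDefinable P)
    (t : V ⟶ W) : ElemDefinable fun w => ∃ v, P v ∧ v ≫ t = w := by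
  obtain ⟨R, r, hr⟩ := hP
  exact ⟨R, r ≫ t, fun w => by simp only [hr, mem_comp_iff]⟩

/-- Fullness in the form used below: the relation to be refined is specified by a definable
predicate, with no representing arrow in sight. -/
theorem IsFullFamily.exists_elem {Y X I F P : C} {g : Y ⟶ X} {f : X ⟶ I} {φ : F ⟶ I}
    {α : P ⟶ F ⨯ (X ⨯ Y)} (h : IsFullFamily g f φ α) (i : Elem I) (S : Elem X → Elem Y → Prop)
    (hS : ElemDefinable fun w : Elem (X ⨯ Y) => S (w ≫ prod.fst) (w ≫ prod.snd))
    (hsec : ∀ x y, S x y → y ≫ g = x) (hdom : ∀ x, x ≫ f = i ↔ ∃ y, S x y) :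
    ∃ c : Elem F, c ≫ φ = i ∧ ∀ x y, Mem (triple c x y) α → S x y := by
  obtain ⟨R, r, hr⟩ := hS
  have hr' : ∀ x y, Mem (pair x y) r ↔ S x y := fun x y => by
    simpa only [prod.lift_fst, prod.lift_snd] using (hr (pair x y)).symm
  obtain ⟨c, hc, hc'⟩ := h.full r i (isPseudoRelation_iff.2 (by
    simp only [hr']
    exact ⟨hsec, hdom⟩))
  exact ⟨c, hc, fun x y hxy => (hr' x y).1 (hc' x y hxy)⟩

variable [HasWeakEqualizers C]

theorem ElemDefinable.eq {V W : C} (s t : V ⟶ W) :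
    ElemDefinable fun v : Elem V => v ≫ s = v ≫ t := by
  refine ⟨_, weakEqualizer.ι s t, fun v => ⟨fun h => ⟨weakEqualizer.lift v h,
    weakEqualizer.lift_ι v h⟩, ?_⟩⟩
  rintro ⟨e, rfl⟩
  rw [Category.assoc, Category.assoc, weakEqualizer.condition]

theorem ElemDefinable.comap {V W : C} {P : Elem W → Prop} (hP : ElemDefinable P) (t : V ⟶ W) :
    ElemDefinable fun v => P (v ≫ t) := by
  obtain ⟨R, r, hr⟩ := hP
  refine ⟨_, weakPullback.fst t r, fun v => (hr _).trans ?_⟩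
  constructor
  · rintro ⟨x, hx⟩
    obtain ⟨l, hl, -⟩ := weakPullback.exists_lift t r v x hx.symm
    exact ⟨l, hl⟩
  · rintro ⟨l, rfl⟩
    refine ⟨l ≫ weakPullback.snd t r, ?_⟩
    rw [Category.assoc, Category.assoc, weakPullback.condition]

theorem ElemDefinable.and {W : C} {P Q : Elem W → Prop} (hP : ElemDefinable P)
    (hQ : ElemDefinable Q) : ElemDefinable fun w => P w ∧ Q w := by
  obtain ⟨R, r, hr⟩ := hP
  obtain ⟨S, s, hs⟩ := hQ.comap r
  refine ⟨S, s ≫ r, fun w => ?_⟩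
  rw [mem_comp_iff]
  constructor
  · rintro ⟨h, h'⟩
    obtain ⟨x, rfl⟩ := (hr w).1 h
    exact ⟨x, (hs x).1 h', rfl⟩
  · rintro ⟨x, h, rfl⟩
    exact ⟨(hr _).2 ⟨x, rfl⟩, (hs x).2 h⟩

/-- If `g` represents `P`, a full family over `g, f` has a member over `i` exactly when the whole
fibre over `i` satisfies `P`, so its index arrow `φ` represents the universal quantification. When
the fibre satisfies `P`, the restriction of the converse graph of `g` to it is a pseudo-relation,
and fullness yields a member over `i`. -/
theorem ElemDefinable.forall_along [HasFullFamilies C] {X I : C} {P : Elem X → Prop}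
    (hP : ElemDefinable P) (f : X ⟶ I) : ElemDefinable fun i => ∀ x, x ≫ f = i → P x := by
  obtain ⟨Y, g, hg⟩ := hP
  obtain ⟨F, R, φ, α, h⟩ := HasFullFamilies.closed g f
  refine ⟨F, φ, fun i => ⟨fun hi => ?_, ?_⟩⟩
  · obtain ⟨c, hc, -⟩ := h.exists_elem i (fun x y => y ≫ g = x ∧ x ≫ f = i)
      (((ElemDefinable.eq (prod.snd ≫ g) prod.fst).and
        (ElemDefinable.eq (prod.fst ≫ f) (terminal.from (X ⨯ Y) ≫ i))).congr fun w => by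
          rw [elem_comp_toUnit, Category.assoc, Category.assoc])
      (fun x y h => h.1)
      (fun x => ⟨fun hx => ((hg x).1 (hi x hx)).imp fun y hy => ⟨hy, hx⟩, fun ⟨y, hy⟩ => hy.2⟩)
    exact ⟨c, hc⟩
  · rintro ⟨c, rfl⟩ x hx
    obtain ⟨y, hy⟩ := (h.isFamily.domain c x).1 hx
    exact (hg x).2 ⟨y, h.isFamily.isSection _ _ _ hy⟩

/-- An implication is quantification over the possibly empty fibre of an arrow representing its
premise. -/
theorem ElemDefinable.imp [HasFullFamilies C] {W : C} {P Q : Elem W → Prop}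
    (hP : ElemDefinable P) (hQ : ElemDefinable Q) : ElemDefinable fun w => P w → Q w := by
  obtain ⟨R, r, hr⟩ := hP
  refine ((hQ.comap r).forall_along r).congr fun w => ?_
  rw [hr]
  exact ⟨fun h x hx => hx ▸ h ⟨x, hx⟩, fun h ⟨x, hx⟩ => hx ▸ h x hx⟩

section Choice

variable [HasChoice C]

/-- The hypothesis makes the weak pullback of `r` along `f` surjective onto `V`; a section of it
composed with the other projection is the factorisation. -/
theorem exists_factor {V W R : C} (r : R ⟶ W) (f : V ⟶ W) (h : ∀ v : Elem V, Mem (v ≫ f) r) :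
    ∃ k : V ⟶ R, k ≫ r = f := by
  obtain ⟨s, hs⟩ := HasChoice.isChoiceObject V (weakPullback.fst f r) (fun v => by
    obtain ⟨x, hx⟩ := h v
    obtain ⟨l, hl, -⟩ := weakPullback.exists_lift f r v x hx.symm
    exact ⟨l, hl⟩)
  refine ⟨s ≫ weakPullback.snd f r, ?_⟩
  rw [Category.assoc, ← weakPullback.condition, ← Category.assoc, hs, Category.id_comp]

/-- Internal axiom of choice: the first projection of a total definable relation is surjective, and
a section of it selects the values. -/
theorem ElemDefinable.exists_hom {V W : C} {S : Elem V → Elem W → Prop}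
    (hS : ElemDefinable fun w : Elem (V ⨯ W) => S (w ≫ prod.fst) (w ≫ prod.snd))
    (h : ∀ v, ∃ w, S v w) : ∃ f : V ⟶ W, ∀ v, S v (v ≫ f) := by
  obtain ⟨R, r, hr⟩ := hS
  obtain ⟨k, hk⟩ := exists_factor (r ≫ prod.fst) (𝟙 V) (fun v => by
    obtain ⟨w, hw⟩ := h v
    rw [mem_comp_iff, Category.comp_id]
    exact ⟨prod.lift v w, (hr _).1 (by simpa only [prod.lift_fst, prod.lift_snd] using hw),
      by rw [prod.lift_fst]⟩)
  refine ⟨k ≫ r ≫ prod.snd, fun v => ?_⟩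
  have := (hr (v ≫ k ≫ r)).2 ⟨v ≫ k, Category.assoc _ _ _⟩
  simp only [Category.assoc] at this
  rwa [hk, Category.comp_id] at this

end Choice

end Definability

/-! ### Presented sets, tracked maps and their internal logic -/

section Presentation

variable (C : Type u) [Category.{v} C] [HasFiniteProducts C]

/-- A presentation of a type as the quotient of the elements of an object by a definable
equivalence relation. -/
class Presentation (T : Type v) where
  obj : C
  proj : Elem obj → T
  surj : Function.Surjective proj
  ker : ElemDefinable fun p : Elem (obj ⨯ obj) => proj (p ≫ prod.fst) = proj (p ≫ prod.snd)

open Presentation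

section

variable {S T T' : Type v} [Presentation C S] [Presentation C T] [Presentation C T']

/-- Definable predicates on presented types. -/
def Definable (P : T → Prop) : Prop :=
  ElemDefinable fun w : Elem (obj T : C) => P (proj w)

/-- Maps between presented types that are induced by an arrow. -/
@[fun_prop]
def Tracked (f : T → T') : Prop :=
  ∃ t : (obj T : C) ⟶ (obj T' : C), ∀ w, f (proj w) = proj (w ≫ t)

variable {C}

@[fun_prop]
theorem Tracked.id : Tracked C (fun t : T => t) := ⟨𝟙 _, fun w => by rw [Category.comp_id]⟩

@[fun_prop]
theorem Tracked.const (t' : T') : Tracked C (fun _ : T => t') := by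
  obtain ⟨w', rfl⟩ := surj (C := C) t'
  exact ⟨terminal.from _ ≫ w', fun w => by rw [elem_comp_toUnit]⟩

@[fun_prop]
theorem Tracked.comp {g : T → T'} {f : S → T} (hg : Tracked C g) (hf : Tracked C f) :
    Tracked C (fun s => g (f s)) := by
  obtain ⟨a, ha⟩ := hf
  obtain ⟨b, hb⟩ := hg
  exact ⟨a ≫ b, fun w => by simp only [ha, hb, Category.assoc]⟩

end

instance Presentation.elem [HasWeakEqualizers C] (X : C) : Presentation C (Elem X) where
  obj := X
  proj := id
  surj := Function.surjective_id
  ker := ElemDefinable.eq _ _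

variable [HasWeakEqualizers C]

instance Presentation.prod (T T' : Type v) [Presentation C T] [Presentation C T'] :
    Presentation C (T × T') where
  obj := (obj T : C) ⨯ (obj T' : C)
  proj w := (proj (w ≫ prod.fst), proj (w ≫ prod.snd))
  surj := by
    rintro ⟨t, t'⟩
    obtain ⟨w, rfl⟩ := surj (C := C) t
    obtain ⟨w', rfl⟩ := surj (C := C) t'
    exact ⟨prod.lift w w', by simp only [prod.lift_fst, prod.lift_snd]⟩
  ker := by
    have h := (ker (C := C) (T := T)).comap (prod.map prod.fst prod.fst :
      ((obj T : C) ⨯ (obj T' : C)) ⨯ ((obj T : C) ⨯ (obj T' : C)) ⟶ _)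
    have h' := (ker (C := C) (T := T')).comap (prod.map prod.snd prod.snd :
      ((obj T : C) ⨯ (obj T' : C)) ⨯ ((obj T : C) ⨯ (obj T' : C)) ⟶ _)
    simpa using h.and h'

variable {C} {S T T' : Type v} [Presentation C S] [Presentation C T] [Presentation C T']

theorem Tracked.fst' : Tracked C (Prod.fst : T × T' → T) := ⟨prod.fst, fun _ => rfl⟩

theorem Tracked.snd' : Tracked C (Prod.snd : T × T' → T') := ⟨prod.snd, fun _ => rfl⟩

@[fun_prop]
theorem Tracked.fst {f : S → T × T'} (hf : Tracked C f) : Tracked C (fun s => (f s).1) :=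
  Tracked.fst'.comp hf

@[fun_prop]
theorem Tracked.snd {f : S → T × T'} (hf : Tracked C f) : Tracked C (fun s => (f s).2) :=
  Tracked.snd'.comp hf

@[fun_prop]
theorem Tracked.prodMk {f : S → T} {g : S → T'} (hf : Tracked C f) (hg : Tracked C g) :
    Tracked C (fun s => (f s, g s)) := by
  obtain ⟨a, ha⟩ := hf
  obtain ⟨b, hb⟩ := hg
  exact ⟨prod.lift a b, fun w => by
    simp only [Presentation.proj, ha, hb, Category.assoc, prod.lift_fst, prod.lift_snd]⟩

theorem Tracked.proj : Tracked C (Presentation.proj : Elem (obj T : C) → T) :=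
  ⟨𝟙 _, fun w => congrArg _ (Category.comp_id w).symm⟩

theorem Tracked.comp_hom {X Y : C} (t : X ⟶ Y) : Tracked C (fun x : Elem X => x ≫ t) :=
  ⟨t, fun _ => rfl⟩

theorem Definable.comp {P : T → Prop} (hP : Definable C P) {f : S → T} (hf : Tracked C f) :
    Definable C fun s => P (f s) := by
  obtain ⟨t, ht⟩ := hf
  simpa only [Definable, ht] using ElemDefinable.comap hP t

theorem Definable.comp₂ {R : T → T' → Prop} (hR : Definable C fun p : T × T' => R p.1 p.2)
    {f : S → T} {g : S → T'} (hf : Tracked C f) (hg : Tracked C g) :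
    Definable C fun s => R (f s) (g s) :=
  Definable.comp (f := fun s => (f s, g s)) hR (by fun_prop)

theorem Definable.comp₃ {U : Type v} [Presentation C U] {R : T → T' → U → Prop}
    (hR : Definable C fun p : (T × T') × U => R p.1.1 p.1.2 p.2)
    {f : S → T} {g : S → T'} {h : S → U} (hf : Tracked C f) (hg : Tracked C g)
    (hh : Tracked C h) : Definable C fun s => R (f s) (g s) (h s) :=
  Definable.comp (f := fun s => ((f s, g s), h s)) hR (by fun_prop)

theorem Definable.and {P Q : T → Prop} (hP : Definable C P) (hQ : Definable C Q) :
    Definable C fun t => P t ∧ Q t :=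
  ElemDefinable.and hP hQ

theorem Definable.eq {f g : S → T} (hf : Tracked C f) (hg : Tracked C g) :
    Definable C fun s => f s = g s :=
  Definable.comp₂ (R := fun t t' : T => t = t') (Presentation.ker (C := C) (T := T)) hf hg

theorem Definable.exists {P : T → T' → Prop} (hP : Definable C fun p : T × T' => P p.1 p.2) :
    Definable C fun t => ∃ t', P t t' := by
  refine (ElemDefinable.exists_along hP prod.fst).congr fun w => (surj (C := C) (T := T')).exists.trans ?_
  constructor
  · rintro ⟨w', h⟩
    exact ⟨prod.lift w w', by simpa only [Presentation.proj, prod.lift_fst, prod.lift_snd] using h,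
      prod.lift_fst _ _⟩
  · rintro ⟨p, h, rfl⟩
    exact ⟨p ≫ prod.snd, h⟩

theorem Definable.imp [HasFullFamilies C] {P Q : T → Prop} (hP : Definable C P)
    (hQ : Definable C Q) : Definable C fun t => P t → Q t :=
  ElemDefinable.imp hP hQ

theorem Definable.iff [HasFullFamilies C] {P Q : T → Prop} (hP : Definable C P)
    (hQ : Definable C Q) : Definable C fun t => P t ↔ Q t := by
  simpa only [iff_iff_implies_and_implies] using (hP.imp hQ).and (hQ.imp hP)

theorem Definable.forall [HasFullFamilies C] {P : T → T' → Prop}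
    (hP : Definable C fun p : T × T' => P p.1 p.2) : Definable C fun t => ∀ t', P t t' := by
  refine (ElemDefinable.forall_along hP prod.fst).congr fun w => (surj (C := C) (T := T')).forall.trans ?_
  constructor
  · rintro h p rfl
    exact h (p ≫ prod.snd)
  · rintro h w'
    simpa only [Presentation.proj, prod.lift_fst, prod.lift_snd] using
      h (prod.lift w w') (prod.lift_fst _ _)

/-- Choice selects an arrow on representatives; uniqueness of the value makes it independent of the
representative. -/
theorem Tracked.exists_of_definable [HasChoice C] {R : T → T' → Prop}
    (hR : Definable C fun p : T × T' => R p.1 p.2) (h : ∀ t, ∃! t', R t t') :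
    ∃ f : T → T', Tracked C f ∧ ∀ t, R t (f t) := by
  choose f hf hf' using h
  refine ⟨f, ?_, hf⟩
  obtain ⟨t, ht⟩ := ElemDefinable.exists_hom
    (S := fun (v : Elem (obj T : C)) (w : Elem (obj T' : C)) => R (Presentation.proj v)
      (Presentation.proj w)) hR (fun v => by
        obtain ⟨w, hw⟩ := surj (C := C) (f (Presentation.proj v))
        exact ⟨w, hw ▸ hf _⟩)
  exact ⟨t, fun w => (hf' _ _ (ht w)).symm⟩

theorem Tracked.of_definable [HasChoice C] {f : T → T'}
    (hf : Definable C fun p : T × T' => f p.1 = p.2) : Tracked C f := by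
  obtain ⟨g, hg, h⟩ := Tracked.exists_of_definable (R := fun t t' => f t = t') hf
    (fun t => ⟨f t, rfl, fun _ h => h.symm⟩)
  rwa [funext h]

/-- The quotient of a presented type by a definable equivalence relation. -/
abbrev Presentation.ofSurjective (f : S → T') (hf : Function.Surjective f)
    (hker : Definable C fun p : S × S => f p.1 = f p.2) : Presentation C T' where
  obj := (obj S : C)
  proj w := f (proj w)
  surj := hf.comp surj
  ker := hker

/-- Replaces the subobject cut out by `P`, which need not exist in `C`, by a cover of it with
elements as parameters. -/
theorem Definable.exists_range {P : T → Prop} (hP : Definable C P) :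
    ∃ (W : C) (f : Elem W → T), Tracked C f ∧ ∀ t, P t ↔ ∃ w, f w = t := by
  obtain ⟨W, r, hr⟩ := hP
  refine ⟨W, fun w => Presentation.proj (w ≫ r), ⟨r, fun _ => rfl⟩, fun t => ⟨fun h => ?_, ?_⟩⟩
  · obtain ⟨w, rfl⟩ := surj (C := C) t
    exact ((hr w).1 h).imp fun x hx => congrArg _ hx
  · rintro ⟨w, rfl⟩
    exact (hr _).2 ⟨w, rfl⟩

theorem Definable.exists_presentation {P : T → Prop} (hP : Definable C P) :
    ∃ _ : Presentation C {t // P t}, Tracked C (Subtype.val : {t // P t} → T) := by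
  obtain ⟨W, f, hf, h⟩ := hP.exists_range
  refine ⟨Presentation.ofSurjective (fun w : Elem W => ⟨f w, (h _).2 ⟨w, rfl⟩⟩) ?_ ?_, ?_⟩
  · rintro ⟨t, ht⟩
    exact ((h t).1 ht).imp fun w hw => Subtype.ext hw
  · simp only [Subtype.mk.injEq]
    exact Definable.eq (hf.comp Tracked.fst') (hf.comp Tracked.snd')
  · exact hf

theorem Tracked.subtype_mk [HasChoice C] {P : T → Prop} [Presentation C {t // P t}]
    (hval : Tracked C (Subtype.val : {t // P t} → T)) {f : S → T} (hf : Tracked C f)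
    (h : ∀ s, P (f s)) : Tracked C fun s => (⟨f s, h s⟩ : {t // P t}) := by
  refine Tracked.of_definable ?_
  simp only [Subtype.ext_iff]
  exact Definable.eq (hf.comp Tracked.fst') (hval.comp Tracked.snd')

end Presentation

end WeaklyCartesian

end

/-! ### Points of the exact completion and finite limits -/

noncomputable section

namespace WeaklyCartesian

variable {C : Type u} [Category.{v} C] [HasFiniteProducts C] [HasWeakEqualizers C]

open Presentation

theorem isPseudoEquivRel_of_equivalence [HasChoice C] {X R : C} (r : R ⟶ X ⨯ X)
    (h : Equivalence fun x y : Elem X => Mem (pair x y) r) : IsPseudoEquivRel r where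
  refl := exists_factor r _ fun v => by
    rw [prod.comp_lift, Category.comp_id]
    exact h.refl v
  symm := exists_factor r _ fun v => by
    rw [prod.comp_lift]
    exact h.symm ⟨v, by rw [← Category.assoc, ← Category.assoc]; exact (elem_prod_eta _).symm⟩
  trans := exists_factor r _ fun v => by
    rw [prod.comp_lift]
    refine h.trans (y := v ≫ weakPullback.fst (r ≫ prod.snd) (r ≫ prod.fst) ≫ r ≫ prod.snd)
      ⟨v ≫ weakPullback.fst _ _, ?_⟩ ⟨v ≫ weakPullback.snd _ _, ?_⟩
    · ext <;> simp only [Category.assoc, prod.lift_fst, prod.lift_snd]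
    · rw [weakPullback.condition]
      ext <;> simp only [Category.assoc, prod.lift_fst, prod.lift_snd]

namespace ExactCompletion

/-- Two elements of the carrier are identified if they are related. -/
def pointSetoid (A : ExactCompletion C) : Setoid (Elem A.carrier) where
  r a b := A.Related a b
  iseqv := ⟨Related.refl A, Related.symm, Related.trans⟩

/-- The points of an object of the exact completion: elements of the carrier up to the
pseudo-equivalence relation. -/
def Point (A : ExactCompletion C) : Type v := Quotient (pointSetoid A)

/-- The point represented by an element of the carrier. -/
def Point.mk {A : ExactCompletion C} (a : Elem A.carrier) : Point A :=
  Quotient.mk (pointSetoid A) a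

theorem Point.mk_eq_mk_iff {A : ExactCompletion C} {a b : Elem A.carrier} :
    Point.mk a = Point.mk b ↔ A.Related a b :=
  Quotient.eq (r := pointSetoid A)

instance (A : ExactCompletion C) : Presentation C (Point A) where
  obj := A.carrier
  proj := Point.mk
  surj := Quotient.mk_surjective
  ker := ⟨A.dom, A.rel, fun w => Point.mk_eq_mk_iff.trans (by
    unfold Related Mem
    rw [elem_prod_eta])⟩

/-- The action of an arrow of the exact completion on points. -/
def mapPoint {A B : ExactCompletion C} (f : A ⟶ B) : Point A → Point B :=
  Quotient.map₂ (sa := preHomSetoid A B) (sb := pointSetoid A) (sc := pointSetoid B)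
    (fun f a => a ≫ f.1)
    (fun _ g hfg a _ hab => (Related.comp_left a hfg).trans (Related.comp_right hab g)) f

section

variable {A B D : ExactCompletion C}

@[simp]
theorem mapPoint_comp (f : A ⟶ B) (g : B ⟶ D) (p : Point A) :
    mapPoint (f ≫ g) p = mapPoint g (mapPoint f p) := by
  induction p using Quotient.inductionOn with
  | h a =>
    induction f using Quotient.inductionOn with
    | h f =>
      induction g using Quotient.inductionOn with
      | h g => exact congrArg Point.mk (Category.assoc a f.1 g.1).symm

@[fun_prop]
theorem tracked_mapPoint (f : A ⟶ B) : Tracked C (mapPoint f) := by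
  induction f using Quotient.inductionOn with
  | h f => exact ⟨f.1, fun _ => rfl⟩

variable [HasChoice C]

theorem related_iff {W : C} {f g : W ⟶ B.carrier} :
    B.Related f g ↔ ∀ w : Elem W, B.Related (w ≫ f) (w ≫ g) := by
  refine ⟨fun h w => Related.comp_left w h, fun h => exists_factor _ _ fun w => ?_⟩
  rw [prod.comp_lift]
  exact h w

theorem hom_ext_point {f g : A ⟶ B} (h : ∀ p, mapPoint f p = mapPoint g p) : f = g := by
  induction f using Quotient.inductionOn with
  | h f =>
    induction g using Quotient.inductionOn with
    | h g =>
      exact Quotient.sound (related_iff.2 fun w => Point.mk_eq_mk_iff.1 (h (Point.mk w)))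

/-- An arrow tracking `F` sends related elements to related elements because `F` is well defined on
points; choice assembles these witnesses into a lift to the relations. -/
theorem exists_mapPoint_eq {F : Point A → Point B} (hF : Tracked C F) :
    ∃ f : A ⟶ B, ∀ p, mapPoint f p = F p := by
  obtain ⟨t, ht⟩ := hF
  refine ⟨Quotient.mk (preHomSetoid A B) ⟨t, exists_factor _ _ fun w => ?_⟩, fun p => ?_⟩
  · have h : Point.mk ((w ≫ A.rel ≫ prod.fst) ≫ t) = Point.mk ((w ≫ A.rel ≫ prod.snd) ≫ t) := by
      refine (ht _).symm.trans ((congrArg F (Point.mk_eq_mk_iff.2 ⟨w, ?_⟩)).trans (ht _))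
      rw [← Category.assoc, ← Category.assoc, elem_prod_eta]
    obtain ⟨k, hk⟩ := Point.mk_eq_mk_iff.1 h
    refine ⟨k, hk.trans ?_⟩
    ext <;> simp only [Category.assoc, prod.lift_fst, prod.lift_snd, prod.map_fst, prod.map_snd]
  · induction p using Quotient.inductionOn with
    | h a => exact (ht a).symm

end

variable [HasChoice C]

variable (C) in
-- The arrow representing the kernel of the presentation is itself a pseudo-equivalence relation,
-- and the identity of its carrier tracks both directions.
theorem exists_point_equiv (T : Type v) [Presentation C T] :
    ∃ (A : ExactCompletion C) (e : Point A ≃ T), Tracked C e ∧ Tracked C e.symm := by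
  obtain ⟨R, r, hr⟩ := Presentation.ker (C := C) (T := T)
  have hr' : ∀ x y : Elem (obj T : C), Mem (pair x y) r ↔ proj x = proj y := fun x y => by
    simpa only [prod.lift_fst, prod.lift_snd] using (hr (pair x y)).symm
  let A : ExactCompletion C := ⟨obj T, R, r, isPseudoEquivRel_of_equivalence r (by
    simp only [hr']
    exact ⟨fun _ => rfl, Eq.symm, Eq.trans⟩)⟩
  have hA : ∀ a b : Elem A.carrier, A.Related a b ↔ proj (T := T) a = proj b := hr'
  let φ : Point A → T := Quotient.lift (s := pointSetoid A) (proj (T := T))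
    fun a b h => (hA a b).1 h
  have hφ : Function.Bijective φ := by
    constructor
    · intro p q h
      induction p using Quotient.inductionOn with
      | h a =>
        induction q using Quotient.inductionOn with
        | h b => exact Point.mk_eq_mk_iff.2 ((hA a b).2 h)
    · intro t
      obtain ⟨w, rfl⟩ := surj (C := C) t
      exact ⟨Point.mk w, rfl⟩
  refine ⟨A, Equiv.ofBijective φ hφ, ⟨𝟙 _, fun w => congrArg _ (Category.comp_id w).symm⟩,
    ⟨𝟙 _, fun w => ?_⟩⟩
  rw [Category.comp_id, Equiv.symm_apply_eq]
  rfl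

variable (C) in
theorem hasTerminal : HasTerminal (ExactCompletion C) := by
  let _ : Presentation C PUnit.{v + 1} :=
    { obj := ⊤_ C
      proj := fun _ => ⟨⟩
      surj := fun _ => ⟨𝟙 _, rfl⟩
      ker := (ElemDefinable.eq prod.fst prod.fst).congr fun w => by simp }
  obtain ⟨A, e, -, -⟩ := exists_point_equiv C PUnit.{v + 1}
  refine (IsTerminal.ofUniqueHom (Y := A)
    (fun B => (exists_mapPoint_eq (Tracked.const (C := C) (e.symm ⟨⟩))).choose)
    fun B m => hom_ext_point fun p => e.injective rfl).hasTerminal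

theorem hasLimit_cospan {A B X : ExactCompletion C} (f : A ⟶ X) (g : B ⟶ X) :
    HasLimit (cospan f g) := by
  obtain ⟨_, hval⟩ := Definable.exists_presentation (C := C)
    (P := fun p : Point A × Point B => mapPoint f p.1 = mapPoint g p.2)
    (Definable.eq (by fun_prop) (by fun_prop))
  obtain ⟨P, e, he, he'⟩ := exists_point_equiv C
    {p : Point A × Point B // mapPoint f p.1 = mapPoint g p.2}
  obtain ⟨a, ha⟩ := exists_mapPoint_eq (C := C) (F := fun p : Point P => (e p).1.1)
    ((hval.comp he).fst)
  obtain ⟨b, hb⟩ := exists_mapPoint_eq (C := C) (F := fun p : Point P => (e p).1.2)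
    ((hval.comp he).snd)
  have w : a ≫ f = b ≫ g := hom_ext_point fun p => by
    rw [mapPoint_comp, mapPoint_comp, ha, hb]
    exact (e p).2
  have key : ∀ (Z : ExactCompletion C) (s : Z ⟶ A) (t : Z ⟶ B), s ≫ f = t ≫ g →
      ∃ l : Z ⟶ P, l ≫ a = s ∧ l ≫ b = t := by
    intro Z s t h
    have h' : ∀ z, mapPoint f (mapPoint s z, mapPoint t z).1 =
        mapPoint g (mapPoint s z, mapPoint t z).2 := fun z => by
      simpa using congrArg (mapPoint · z) h
    obtain ⟨l, hl⟩ := exists_mapPoint_eq (he'.comp (Tracked.subtype_mk hval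
      (f := fun z : Point Z => (mapPoint s z, mapPoint t z)) (by fun_prop) h'))
    exact ⟨l, hom_ext_point fun z => by simp [ha, hl], hom_ext_point fun z => by simp [hb, hl]⟩
  refine ⟨⟨⟨PullbackCone.mk a b w, PullbackCone.IsLimit.mk w
    (fun s => (key s.pt s.fst s.snd s.condition).choose)
    (fun s => (key s.pt s.fst s.snd s.condition).choose_spec.1)
    (fun s => (key s.pt s.fst s.snd s.condition).choose_spec.2)
    (fun s m hm hm' => hom_ext_point fun z => e.injective (Subtype.ext (Prod.ext ?_ ?_)))⟩⟩⟩
  · rw [← ha, ← ha, ← mapPoint_comp, ← mapPoint_comp, hm,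
      (key s.pt s.fst s.snd s.condition).choose_spec.1]
  · rw [← hb, ← hb, ← mapPoint_comp, ← mapPoint_comp, hm',
      (key s.pt s.fst s.snd s.condition).choose_spec.2]

variable (C) in
theorem hasFiniteLimits : HasFiniteLimits (ExactCompletion C) :=
  have := hasTerminal C
  have : HasPullbacks (ExactCompletion C) :=
    have : ∀ {X Y Z : ExactCompletion C} {f : X ⟶ Z} {g : Y ⟶ Z}, HasLimit (cospan f g) :=
      hasLimit_cospan _ _
    hasPullbacks_of_hasLimit_cospan _
  hasFiniteLimits_of_hasTerminal_and_pullbacks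

theorem exists_point_pullback {A B X : ExactCompletion C} (f : A ⟶ X) (g : B ⟶ X)
    [HasPullback f g] {a : Point A} {b : Point B} (h : mapPoint f a = mapPoint g b) :
    ∃ p : Point (pullback f g), mapPoint (pullback.fst f g) p = a ∧
      mapPoint (pullback.snd f g) p = b := by
  -- Constant arrows stand in for points, so that the universal property applies. Any domain with a
  -- point will do; `A` has the point `a`.
  obtain ⟨s, hs⟩ := exists_mapPoint_eq (A := A) (Tracked.const (C := C) a)
  obtain ⟨t, ht⟩ := exists_mapPoint_eq (A := A) (Tracked.const (C := C) b)
  have w : s ≫ f = t ≫ g := hom_ext_point fun z => by simp [hs, ht, h]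
  exact ⟨mapPoint (pullback.lift s t w) a, by rw [← mapPoint_comp, pullback.lift_fst, hs],
    by rw [← mapPoint_comp, pullback.lift_snd, ht]⟩

theorem point_pullback_ext {A B X : ExactCompletion C} {f : A ⟶ X} {g : B ⟶ X}
    [HasPullback f g] {p q : Point (pullback f g)}
    (h : mapPoint (pullback.fst f g) p = mapPoint (pullback.fst f g) q)
    (h' : mapPoint (pullback.snd f g) p = mapPoint (pullback.snd f g) q) : p = q := by
  obtain ⟨s, hs⟩ := exists_mapPoint_eq (A := pullback f g) (Tracked.const (C := C) p)
  obtain ⟨t, ht⟩ := exists_mapPoint_eq (A := pullback f g) (Tracked.const (C := C) q)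
  have hst : s = t := pullback.hom_ext (hom_ext_point fun z => by simp [hs, ht, h])
    (hom_ext_point fun z => by simp [hs, ht, h'])
  rw [← hs p, ← ht p, hst]

end ExactCompletion

end WeaklyCartesian

end

noncomputable section

namespace WeaklyCartesian

/-! ### Presenting the set of definable functions between fibres -/

section LocalSections

variable {C : Type u} [Category.{v} C] [HasFiniteProducts C] [HasWeakEqualizers C]

open Presentation

theorem Tracked.lift {S : Type v} [Presentation C S] {X Y : C} {f : S → Elem X} {g : S → Elem Y}
    (hf : Tracked C f) (hg : Tracked C g) : Tracked C fun s => prod.lift (f s) (g s) := by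
  obtain ⟨a, ha⟩ := hf
  obtain ⟨b, hb⟩ := hg
  exact ⟨prod.lift a b, fun w => (congrArg₂ prod.lift (ha w) (hb w)).trans
    (prod.comp_lift w a b).symm⟩

theorem Tracked.exists_eq_comp {X Y : C} {f : Elem X → Elem Y} (hf : Tracked C f) :
    ∃ t : X ⟶ Y, ∀ x, f x = x ≫ t := hf

/-- For maps `α : A → X` and `β : B → X`, a definable relation that is the graph of a function
from the fibre of `α` over `x` to the fibre of `β` over `x`. -/
structure IsLocalSection {A B X : Type v} [Presentation C A] [Presentation C B]
    (α : A → X) (β : B → X) (x : X) (S : A → B → Prop) : Prop where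
  definable : Definable C fun p : A × B => S p.1 p.2
  left : ∀ a b, S a b → α a = x
  right : ∀ a b, S a b → β b = x
  total : ∀ a, α a = x → ∃ b, S a b
  unique : ∀ a b b', S a b → S a b' → b = b'

variable [HasFullFamilies C] {A B X : Type v} [Presentation C A] [Presentation C B]
  [Presentation C X]

theorem exists_presentation_localSections {α : A → X} {β : B → X} (hα : Tracked C α)
    (hβ : Tracked C β) :
    ∃ _ : Presentation C {t : X × (A → B → Prop) // IsLocalSection (C := C) α β t.1 t.2},
      Tracked C (fun t : {t : X × (A → B → Prop) // IsLocalSection (C := C) α β t.1 t.2} =>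
        t.1.1) ∧
      Definable C fun p : ({t : X × (A → B → Prop) // IsLocalSection (C := C) α β t.1 t.2} × A) × B
        => p.1.1.1.2 p.1.2 p.2 := by
  have hproj : Tracked C (proj : Elem (obj X : C) → X) := Tracked.proj
  -- Pseudo-relations live in `C`, whereas `α` takes values in a quotient. `Q` parametrises the
  -- pairs of an `a` and a representative of `α a`, so that `f` is a genuine arrow; `Y` below plays
  -- the same role for `B` over `Q`.
  obtain ⟨Q, q, hq, hq'⟩ := Definable.exists_range (C := C)
    (P := fun p : Elem (obj X : C) × A => α p.2 = proj p.1) (Definable.eq (by fun_prop)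
      (by fun_prop))
  obtain ⟨f, hf⟩ := hq.fst.exists_eq_comp
  have hqα : ∀ w, α (q w).2 = proj (w ≫ f) := fun w => by
    rw [← hf]
    exact (hq' _).2 ⟨w, rfl⟩
  have htf := Tracked.comp_hom f
  obtain ⟨Y, y, hy, hy'⟩ := Definable.exists_range (C := C)
    (P := fun p : Elem Q × B => β p.2 = proj (p.1 ≫ f)) (Definable.eq (by fun_prop)
      (by fun_prop))
  obtain ⟨g, hg⟩ := hy.fst.exists_eq_comp
  have hyβ : ∀ w, β (y w).2 = proj ((w ≫ g) ≫ f) := fun w => by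
    rw [← hg]
    exact (hy' _).2 ⟨w, rfl⟩
  obtain ⟨F, P, φ, ρ, hfull⟩ := HasFullFamilies.closed g f
  have htφ := Tracked.comp_hom φ
  have htg := Tracked.comp_hom g
  let M : Elem F → Elem Q → Elem Y → Prop := fun c w w' => Mem (triple c w w') ρ
  have hM : Definable C fun p : (Elem F × Elem Q) × Elem Y => M p.1.1 p.1.2 p.2 := by
    have h : Definable C fun w : Elem (F ⨯ (Q ⨯ Y)) => Mem w ρ := ⟨P, ρ, fun _ => Iff.rfl⟩
    exact h.comp (f := fun p : (Elem F × Elem Q) × Elem Y => triple p.1.1 p.1.2 p.2)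
      (Tracked.lift (by fun_prop) (Tracked.lift (by fun_prop) (by fun_prop)))
  have hMsec : ∀ c w w', M c w w' → w' ≫ g = w := hfull.isFamily.isSection
  have hMdom : ∀ c w, w ≫ f = c ≫ φ ↔ ∃ w', M c w w' := hfull.isFamily.domain
  -- The image in `A` and `B` of the member `c`: it is total on its fibre, but may be multivalued,
  -- as different parameters of one `a` can have different values.
  let R : Elem F → A → B → Prop := fun c a b => ∃ w w', M c w w' ∧ (q w).2 = a ∧ (y w').2 = b
  have hR : Definable C fun p : (Elem F × A) × B => R p.1.1 p.1.2 p.2 := by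
    refine Definable.exists (Definable.exists (Definable.and ?_ (Definable.and ?_ ?_)))
    · exact hM.comp₃ (by fun_prop) (by fun_prop) (by fun_prop)
    · exact Definable.eq (by fun_prop) (by fun_prop)
    · exact Definable.eq (by fun_prop) (by fun_prop)
  -- Only the single-valued members are kept. Implication and universal quantification are needed to
  -- see that this condition is definable.
  obtain ⟨_, hval⟩ := Definable.exists_presentation (C := C)
    (P := fun c : Elem F => ∀ a b b', R c a b → R c a b' → b = b') (by
      refine Definable.forall (Definable.forall (Definable.forall (Definable.imp ?_
        (Definable.imp ?_ ?_))))
      · exact hR.comp₃ (by fun_prop) (by fun_prop) (by fun_prop)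
      · exact hR.comp₃ (by fun_prop) (by fun_prop) (by fun_prop)
      · exact Definable.eq (by fun_prop) (by fun_prop))
  have hRα : ∀ c a b, R c a b → α a = proj (c ≫ φ) := by
    rintro c a b ⟨w, w', h, rfl, rfl⟩
    rw [hqα, (hMdom c w).2 ⟨w', h⟩]
  have hRβ : ∀ c a b, R c a b → β b = proj (c ≫ φ) := by
    rintro c a b ⟨w, w', h, rfl, rfl⟩
    rw [hyβ, hMsec c w w' h, (hMdom c w).2 ⟨w', h⟩]
  have hRtotal : ∀ c a, α a = proj (c ≫ φ) → ∃ b, R c a b := by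
    intro c a h
    obtain ⟨w, hw⟩ := (hq' (c ≫ φ, a)).1 h
    obtain ⟨w', hw'⟩ := (hMdom c w).1 (by rw [← hf, hw])
    exact ⟨(y w').2, w, w', hw', by rw [hw], rfl⟩
  let π : {c : Elem F // ∀ a b b', R c a b → R c a b' → b = b'} →
      {t : X × (A → B → Prop) // IsLocalSection (C := C) α β t.1 t.2} := fun c =>
    ⟨(proj (c.1 ≫ φ), R c.1), ⟨hR.comp₃ (by fun_prop) (by fun_prop) (by fun_prop),
      hRα c.1, hRβ c.1, hRtotal c.1, c.2⟩⟩
  have hπ : Function.Surjective π := by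
    rintro ⟨⟨x, S⟩, hS⟩
    obtain ⟨i, rfl⟩ := surj (C := C) x
    have hdef : Definable C fun p : Elem Q × Elem Y =>
        p.2 ≫ g = p.1 ∧ p.1 ≫ f = i ∧ S (q p.1).2 (y p.2).2 := by
      refine Definable.and ?_ (Definable.and ?_ ?_)
      · exact Definable.eq (by fun_prop) (by fun_prop)
      · exact Definable.eq (by fun_prop) (by fun_prop)
      · exact hS.definable.comp₂ (by fun_prop) (by fun_prop)
    have hdom : ∀ w, w ≫ f = i ↔ ∃ w', w' ≫ g = w ∧ w ≫ f = i ∧ S (q w).2 (y w').2 := by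
      refine fun w => ⟨fun hw => ?_, fun ⟨_, h⟩ => h.2.1⟩
      obtain ⟨b, hb⟩ := hS.total (q w).2 (by rw [hqα, hw])
      obtain ⟨w', hw'⟩ := (hy' (w, b)).1 (by rw [hw]; exact hS.right _ _ hb)
      exact ⟨w', by rw [← hg, hw'], hw, by rwa [hw']⟩
    obtain ⟨c, hc, hcS⟩ := hfull.exists_elem i
      (fun w w' => w' ≫ g = w ∧ w ≫ f = i ∧ S (q w).2 (y w').2) hdef (fun _ _ h => h.1) hdom
    -- Fullness gives only this inclusion. Since `R c` is total on the fibre and `S` is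
    -- single-valued, it forces equality.
    have hcS' : ∀ a b, R c a b → S a b := by
      rintro a b ⟨w, w', h, rfl, rfl⟩
      exact (hcS w w' h).2.2
    refine ⟨⟨c, fun a b b' h h' => hS.unique a b b' (hcS' a b h) (hcS' a b' h')⟩,
      Subtype.ext (Prod.ext (congrArg proj hc) ?_)⟩
    funext a b
    refine propext ⟨hcS' a b, fun h => ?_⟩
    obtain ⟨b', hb'⟩ := hRtotal c a ((hS.left a b h).trans (congrArg proj hc.symm))
    rwa [hS.unique a b b' h (hcS' a b' hb')]
  have hRval : Definable C fun p : ({c : Elem F // ∀ a b b', R c a b → R c a b' → b = b'} × A) × B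
      => R p.1.1.1 p.1.2 p.2 :=
    hR.comp₃ (hval.comp (by fun_prop)) (by fun_prop) (by fun_prop)
  have htval : Tracked C fun c : {c : Elem F // ∀ a b b', R c a b → R c a b' → b = b'} =>
      (proj (c.1 ≫ φ) : X) := hproj.comp (htφ.comp hval)
  refine ⟨Presentation.ofSurjective π hπ ?_, htval, hRval⟩
  have hker : Definable C fun p : {c : Elem F // ∀ a b b', R c a b → R c a b' → b = b'} ×
      {c : Elem F // ∀ a b b', R c a b → R c a b' → b = b'} =>
      (proj (p.1.1 ≫ φ) : X) = proj (p.2.1 ≫ φ) ∧ ∀ a b, R p.1.1 a b ↔ R p.2.1 a b := by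
    refine Definable.and (Definable.eq (htval.comp Tracked.fst') (htval.comp Tracked.snd'))
      (Definable.forall (Definable.forall (Definable.iff ?_ ?_)))
    · exact hR.comp₃ (hval.comp (by fun_prop)) (by fun_prop) (by fun_prop)
    · exact hR.comp₃ (hval.comp (by fun_prop)) (by fun_prop) (by fun_prop)
  simpa only [π, Subtype.ext_iff, Prod.ext_iff, funext_iff, eq_iff_iff] using hker

end LocalSections

/-! ### Exponentials in the slices -/

section Exponentials

open MonoidalCategory

/-- Unique factorisation through `ev` gives bijections natural in `Z`, which already determine a
right adjoint. -/
theorem nonempty_monoidalClosed {V : Type u} [Category.{v} V] [MonoidalCategory V]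
    (h : ∀ A B : V, ∃ (E : V) (ev : A ⊗ E ⟶ B), ∀ (Z : V) (f : A ⊗ Z ⟶ B),
      ∃! k : Z ⟶ E, A ◁ k ≫ ev = f) : Nonempty (MonoidalClosed V) := by
  choose E ev k hk hk' using h
  refine ⟨⟨fun A => ?_⟩⟩
  let e : ∀ Z B, ((tensorLeft A).obj Z ⟶ B) ≃ (Z ⟶ E A B) := fun Z B =>
    { toFun := k A B Z
      invFun := fun l => A ◁ l ≫ ev A B
      left_inv := fun f => hk A B Z f
      right_inv := fun l => (hk' A B Z _ l rfl).symm }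
  have he : ∀ Z' Z B (f : Z' ⟶ Z) (g : (tensorLeft A).obj Z ⟶ B),
      e Z' B ((tensorLeft A).map f ≫ g) = f ≫ e Z B g := fun Z' Z B f g => by
    refine (hk' A B Z' _ _ ?_).symm
    change A ◁ (f ≫ k A B Z g) ≫ ev A B = A ◁ f ≫ g
    rw [MonoidalCategory.whiskerLeft_comp, Category.assoc, hk]
  exact ⟨_, Adjunction.adjunctionOfEquivRight e he⟩

namespace ExactCompletion

variable {C : Type u} [Category.{v} C] [HasFiniteProducts C] [HasWeakEqualizers C]
  [HasChoice C] [HasFullFamilies C]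

attribute [local instance] Over.cartesianMonoidalCategory

theorem exists_exponential [HasPullbacks (ExactCompletion C)] {X : ExactCompletion C}
    (A B : Over X) : ∃ (E : Over X) (ev : A ⊗ E ⟶ B), ∀ (Z : Over X) (f : A ⊗ Z ⟶ B),
      ∃! k : Z ⟶ E, A ◁ k ≫ ev = f := by
  obtain ⟨_, hfst, hmem⟩ := exists_presentation_localSections
    (tracked_mapPoint A.hom) (tracked_mapPoint B.hom)
  obtain ⟨E₀, e, he, he'⟩ := exists_point_equiv C
    {t : Point X × (Point A.left → Point B.left → Prop) //
      IsLocalSection (C := C) (mapPoint A.hom) (mapPoint B.hom) t.1 t.2}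
  obtain ⟨h, hh⟩ := exists_mapPoint_eq (hfst.comp he)
  -- Evaluation sends a function and an argument in its domain to the unique value; it is tracked
  -- because membership in the graph is definable uniformly in the function.
  obtain ⟨ev', hev', hevR⟩ := Tracked.exists_of_definable (C := C)
    (R := fun (p : Point (pullback A.hom h)) (b : Point B.left) =>
      (e (mapPoint (pullback.snd A.hom h) p)).1.2 (mapPoint (pullback.fst A.hom h) p) b)
    (hmem.comp (f := fun p : Point (pullback A.hom h) × Point B.left =>
      ((e (mapPoint (pullback.snd A.hom h) p.1), mapPoint (pullback.fst A.hom h) p.1), p.2))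
      (by fun_prop))
    (fun p => by
      refine existsUnique_of_exists_of_unique ((e _).2.total _ ?_) (fun b b' => (e _).2.unique _ b b')
      rw [← hh, ← mapPoint_comp, ← mapPoint_comp, pullback.condition])
  obtain ⟨ev, hev⟩ := exists_mapPoint_eq hev'
  simp only [← hev] at hevR
  have hevw : ev ≫ B.hom = pullback.fst A.hom h ≫ A.hom := hom_ext_point fun p => by
    rw [mapPoint_comp, mapPoint_comp, (e _).2.right _ _ (hevR p), (e _).2.left _ _ (hevR p)]
  let E : Over X := Over.mk h
  let evE : A ⊗ E ⟶ B := Over.homMk ev hevw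
  have hevE : ∀ (p : Point (A ⊗ E).left), (e (mapPoint (pullback.snd A.hom h) p)).1.2
      (mapPoint (pullback.fst A.hom h) p) (mapPoint evE.left p) := hevR
  have hfstk : ∀ {Z : Over X} (k : Z ⟶ E) (p : Point (A ⊗ Z).left),
      mapPoint (pullback.fst A.hom h) (mapPoint (A ◁ k).left p) =
        mapPoint (pullback.fst A.hom Z.hom) p := fun k p =>
    (mapPoint_comp _ _ p).symm.trans (congrArg (mapPoint · p) (Over.whiskerLeft_left_fst k))
  have hsndk : ∀ {Z : Over X} (k : Z ⟶ E) (p : Point (A ⊗ Z).left),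
      mapPoint (pullback.snd A.hom h) (mapPoint (A ◁ k).left p) =
        mapPoint k.left (mapPoint (pullback.snd A.hom Z.hom) p) := fun k p =>
    (mapPoint_comp _ _ p).symm.trans ((congrArg (mapPoint · p)
      (Over.whiskerLeft_left_snd k)).trans (mapPoint_comp _ _ p))
  have hkw : ∀ {Z : Over X} (k : Z ⟶ E) (z : Point Z.left),
      (e (mapPoint k.left z)).1.1 = mapPoint Z.hom z := fun k z =>
    (hh _).symm.trans ((mapPoint_comp _ _ z).symm.trans (congrArg (mapPoint · z) (Over.w k)))
  have hevk : ∀ {Z : Over X} (k : Z ⟶ E) (p : Point (A ⊗ Z).left),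
      mapPoint evE.left (mapPoint (A ◁ k).left p) = mapPoint (A ◁ k ≫ evE).left p :=
    fun k p => (mapPoint_comp _ _ p).symm
  -- Arrows into `E` with the same evaluation name the same graphs at each `z`. One inclusion is
  -- enough, by symmetry.
  have hle : ∀ {Z : Over X} (k k' : Z ⟶ E), A ◁ k ≫ evE = A ◁ k' ≫ evE → ∀ z a b,
      (e (mapPoint k.left z)).1.2 a b → (e (mapPoint k'.left z)).1.2 a b := by
    intro Z k k' hkk z a b hab
    obtain ⟨p, rfl, rfl⟩ := exists_point_pullback A.hom Z.hom
      (((e _).2.left _ _ hab).trans (hkw k z))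
    have h1 := hevE (mapPoint (A ◁ k).left p)
    have h2 := hevE (mapPoint (A ◁ k').left p)
    rw [hfstk, hsndk, hevk] at h1 h2
    rw [(e _).2.unique _ _ _ hab h1, hkk]
    exact h2
  refine ⟨E, evE, fun Z f => existsUnique_of_exists_of_unique ?_ fun k k' hk hk' => ?_⟩
  -- The transpose of `f` sends `z` to the graph of `f` with its second argument fixed at `z`.
  · let S : Point Z.left → Point A.left → Point B.left → Prop := fun z a b =>
      ∃ p : Point (pullback A.hom Z.hom), mapPoint (pullback.fst A.hom Z.hom) p = a ∧
        mapPoint (pullback.snd A.hom Z.hom) p = z ∧ mapPoint f.left p = b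
    have hsec : ∀ z : Point Z.left, IsLocalSection (C := C) (mapPoint A.hom) (mapPoint B.hom)
        (mapPoint Z.hom z) (S z) := by
      intro z
      refine ⟨?_, ?_, ?_, ?_, ?_⟩
      · refine Definable.exists (Definable.and ?_ (Definable.and ?_ ?_))
        · exact Definable.eq (by fun_prop) (by fun_prop)
        · exact Definable.eq (by fun_prop) (by fun_prop)
        · exact Definable.eq ((tracked_mapPoint f.left).comp Tracked.snd') (by fun_prop)
      · rintro a b ⟨p, rfl, rfl, rfl⟩
        rw [← mapPoint_comp, ← mapPoint_comp, pullback.condition]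
      · rintro a b ⟨p, rfl, rfl, rfl⟩
        refine (mapPoint_comp _ _ p).symm.trans ((congrArg (mapPoint · p) (Over.w f)).trans ?_)
        rw [← mapPoint_comp, ← pullback.condition]
        rfl
      · intro a ha
        obtain ⟨p, hp, hp'⟩ := exists_point_pullback A.hom Z.hom ha
        exact ⟨_, p, hp, hp', rfl⟩
      · rintro a b b' ⟨p, hp, hp', rfl⟩ ⟨p', rfl, rfl, rfl⟩
        rw [point_pullback_ext hp hp']
    obtain ⟨k, hk⟩ := exists_mapPoint_eq (A := Z.left) (B := E₀) (he'.comp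
      (Tracked.of_definable (C := C) (f := fun z => (⟨(mapPoint Z.hom z, S z), hsec z⟩ :
        {t : Point X × (Point A.left → Point B.left → Prop) //
          IsLocalSection (C := C) (mapPoint A.hom) (mapPoint B.hom) t.1 t.2})) (by
        simp only [Subtype.ext_iff, Prod.ext_iff, funext_iff, eq_iff_iff]
        refine Definable.and (Definable.eq (by fun_prop) (hfst.comp Tracked.snd'))
          (Definable.forall (Definable.forall (Definable.iff (Definable.exists
            (Definable.and ?_ (Definable.and ?_ ?_))) ?_)))
        · exact Definable.eq (by fun_prop) (by fun_prop)
        · exact Definable.eq (by fun_prop) (by fun_prop)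
        · exact Definable.eq ((tracked_mapPoint f.left).comp Tracked.snd') (by fun_prop)
        · exact hmem.comp (f := fun p : ((Point Z.left × _) × Point A.left) × Point B.left =>
            ((p.1.1.2, p.1.2), p.2)) (by fun_prop))))
    have hek : ∀ z, e (mapPoint k z) = ⟨(mapPoint Z.hom z, S z), hsec z⟩ := fun z => by
      rw [hk, Equiv.apply_symm_apply]
    let kE : Z ⟶ E := Over.homMk k (hom_ext_point fun z => by
      rw [mapPoint_comp]
      change mapPoint h _ = _
      rw [hh, hek])
    refine ⟨kE, Over.OverMorphism.ext (hom_ext_point fun p => ?_)⟩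
    have h1 := hevE (mapPoint (A ◁ kE).left p)
    rw [hfstk, hsndk, hevk] at h1
    change (e (mapPoint k _)).1.2 _ _ at h1
    rw [hek] at h1
    obtain ⟨p', hp, hp', h2⟩ := h1
    rw [← h2, point_pullback_ext hp hp']
  · refine Over.OverMorphism.ext (hom_ext_point fun z => e.injective (Subtype.ext (Prod.ext
      ((hkw k z).trans (hkw k' z).symm) ?_)))
    funext a b
    exact propext ⟨hle k k' (hk.trans hk'.symm) z a b, hle k' k (hk'.trans hk.symm) z a b⟩

end ExactCompletion

end Exponentials

end WeaklyCartesian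

end

theorem mainTheorem1 (C : Type u) [Category.{v} C] [HasFiniteProducts C] [HasWeakEqualizers C]
    (hchoice : ∀ Y : C, WeaklyCartesian.IsChoiceObject Y)
    (hclosed : WeaklyCartesian.ClosedForPseudoRelations C) :
    WeaklyCartesian.IsLocallyCartesianClosed (WeaklyCartesian.ExactCompletion C) :=
  have : WeaklyCartesian.HasChoice C := ⟨hchoice⟩
  have : WeaklyCartesian.HasFullFamilies C := ⟨hclosed⟩
  have hlim := WeaklyCartesian.ExactCompletion.hasFiniteLimits C
  { hasFiniteLimits := hlim
    cartesianClosed_over := fun X =>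
      letI := Over.cartesianMonoidalCategory X
      WeaklyCartesian.nonempty_monoidalClosed WeaklyCartesian.ExactCompletion.exists_exponential }
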